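/- For natural numbers $n,l\ge 0$ let $d_3(n,l)$ denote the number of derangements (permutations without fixed points) of a set of $n$ elements that have exactly $l$ cycles, all of length at least $3$ (with $d_3(0,0)=1$). For $k\ge 0$ put $$c_k=\sum_{j=0}^{2k}(-1)^j\,\frac{d_3\big(2(j+k),j\big)}{2^{j+k}\,(j+k)!}.$$ Then the Gamma function has the asymptotic expansion $$\Gamma(x)\asymp x^x e^{-x}\frac{\sqrt{2\pi}}{\sqrt x}\sum_{k\ge 0}\frac{c_k}{x^k}\qquad (x\to+\infty,\ x \text{ real}),$$ that is, for every integer $N\ge 0$ and all real $x>0$, $$\Gamma(x)=x^x e^{-x}\frac{\sqrt{2\pi}}{\sqrt x}\Big(\sum_{k=0}^{N}\frac{c_k}{x^k}+R_{N+1}(x)\Big),\qquad R_{N+1}(x)=O\Big(\frac1{x^{N+1}}\Big)\quad\text{as }x\to+\infty .$$ -/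

import Mathlib

/-- `assocDerangements r n l` is the number `d_r(n, l)` of derangements (permutations without fixed
points) of a set of `n` elements that have exactly `l` cycles, all of length at least `r`. Since
a derangement has no fixed points, `cycleType` lists the lengths of all of its cycles. The empty
permutation has no cycles, so that `d_r(0, 0) = 1`. -/
noncomputable def assocDerangements (r n l : ℕ) : ℕ :=
  Nat.card {σ : Equiv.Perm (Fin n) //
    σ ∈ derangements (Fin n) ∧ Multiset.card σ.cycleType = l ∧ ∀ m ∈ σ.cycleType, r ≤ m}

/-- The coefficient
`c_k = ∑_{j=0}^{2k} (-1)^j d_3(2(j+k), j) / (2^{j+k} (j+k)!)`. -/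
noncomputable def comtetCoeff (k : ℕ) : ℝ :=
  ∑ j ∈ Finset.range (2 * k + 1),
    (-1 : ℝ) ^ j * (assocDerangements 3 (2 * (j + k)) j : ℝ) /
      ((2 : ℝ) ^ (j + k) * (Nat.factorial (j + k) : ℝ))

/-! Laplace's method. Putting `t = x (1 + s / √x)` in Euler's integral for `Γ(x + 1) = x Γ(x)` turns
`√x e^x x^(-x) Γ(x)` into the integral of `exp (-s²/2) exp (-s² L(-s/√x))`, extended by zero, where
`L(w) = ∑_{m ≥ 1} w^m / (m + 2)`. Expand the second exponential in powers of `s/√x` and integrate: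
odd Gaussian moments vanish, even ones are `√(2π) (2p)! / (2^p p!)`. So `x^(-k)` gets the
coefficient `∑_l (-1)^l / l! · [w^(2k)] L^l · (2(l+k))! / (2^(l+k) (l+k)!)`. This is `c_k` because
`w² L(w)` generates the cycles of length at least 3, whence `(2(l+k))! [w^(2k)] L^l = l! d_3(2(l+k),
l)` (`assocDerangements_three`). The error (`abs_gammaIntegrand_sub_le`) is bounded by `x^(-R/2)`
times a fixed integrable function: near the peak by positivity of the coefficients of `L`, elsewhere
by exponential decay. -/

/-! ### Derangements and the generating function of cycles -/

/-- The exponential generating function `∑_{m ≥ r} X ^ m / m` of the cycles of length at least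
`r`. -/
noncomputable def cycleSeries (r : ℕ) : PowerSeries ℝ :=
  PowerSeries.mk fun m => if r ≤ m then (m : ℝ)⁻¹ else 0

theorem Multiset.countPerms_mul_prod_factorial (m : Multiset ℕ) :
    m.countPerms * ∏ i ∈ m.toFinset, (m.count i).factorial = (Multiset.card m).factorial := by
  have h := Nat.multinomial_spec m.toFinset (fun i => m.count i)
  rw [Multiset.toFinset_sum_count_eq] at h
  rw [← h, mul_comm, Multiset.countPerms, Finsupp.multinomial_eq, Multiset.toFinsupp_support]
  rfl

theorem Multiset.prod_map_monomial (m : Multiset ℕ) (f : ℕ → ℝ) :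
    (m.map fun i => Polynomial.monomial i (f i)).prod = Polynomial.monomial m.sum (m.map f).prod := by
  induction m using Multiset.induction with
  | empty => simp
  | cons a s ih => simp [ih, Polynomial.monomial_mul_monomial]

/-- Only degrees up to `n` matter, so the series may be truncated to a polynomial and the
multinomial theorem applied. -/
theorem coeff_cycleSeries_pow (r n l : ℕ) :
    PowerSeries.coeff n (cycleSeries r ^ l) =
      ∑ k ∈ (Finset.Icc r n).sym l,
        if k.val.sum = n then (k.val.countPerms : ℝ) * (k.val.map fun i : ℕ => (i : ℝ)⁻¹).prod
        else 0 := by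
  have htrunc : PowerSeries.trunc (n + 1) (cycleSeries r) =
      ∑ i ∈ Finset.Icc r n, Polynomial.monomial i (i : ℝ)⁻¹ := by
    ext m
    simp only [PowerSeries.coeff_trunc, cycleSeries, PowerSeries.coeff_mk, Polynomial.finsetSum_coeff,
      Polynomial.coeff_monomial, Finset.sum_ite_eq', Finset.mem_Icc]
    split_ifs <;> first | rfl | omega
  have h := congrArg (fun p => Polynomial.coeff p n)
    (PowerSeries.trunc_trunc_pow (cycleSeries r) (n + 1) l)
  simp only [PowerSeries.coeff_trunc, Nat.lt_succ_self, if_true] at h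
  rw [← h, htrunc, ← Polynomial.coe_pow, Polynomial.coeff_coe, Finset.sum_pow,
    Polynomial.finsetSum_coeff]
  refine Finset.sum_congr rfl fun k _ => ?_
  rw [Multiset.prod_map_monomial, ← Polynomial.C_eq_natCast, Polynomial.coeff_C_mul,
    Polynomial.coeff_monomial, mul_ite, mul_zero]

theorem Equiv.Perm.mem_derangements_iff_sum_cycleType {n : ℕ} (σ : Equiv.Perm (Fin n)) :
    σ ∈ derangements (Fin n) ↔ σ.cycleType.sum = n := by
  rw [Equiv.Perm.sum_cycleType]
  constructor
  · intro h
    have : σ.support = Finset.univ := by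
      ext x
      simpa using h x
    simp [this]
  · intro h x
    have : σ.support = Finset.univ := by
      rw [← Finset.card_eq_iff_eq_univ, h, Fintype.card_fin]
    have hx : x ∈ σ.support := by simp [this]
    simpa using hx

open Classical in
theorem assocDerangements_eq_sum (r n l : ℕ) :
    assocDerangements r n l =
      ∑ k ∈ (Finset.Icc r n).sym l,
        if k.val.sum = n then
          (Finset.univ.filter fun σ : Equiv.Perm (Fin n) => σ.cycleType = k.val).card
        else 0 := by
  rw [assocDerangements, Nat.card_eq_fintype_card, Fintype.card_subtype, ← Finset.sum_filter,
    ← Finset.card_biUnion]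
  · congr 1
    ext σ
    simp only [Finset.mem_filter, Finset.mem_univ, true_and, Finset.mem_biUnion,
      Equiv.Perm.mem_derangements_iff_sum_cycleType, Finset.mem_sym_iff, Finset.mem_Icc]
    constructor
    · rintro ⟨h1, h2, h3⟩
      refine ⟨⟨σ.cycleType, h2⟩, ⟨fun a ha => ⟨h3 a ha, ?_⟩, h1⟩, rfl⟩
      exact h1 ▸ Multiset.le_sum_of_mem ha
    · rintro ⟨k, ⟨h1, h2⟩, h3⟩
      rw [h3]
      exact ⟨h2, k.2, fun m hm => (h1 m hm).1⟩
  · intro a _ b _ hab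
    rw [Function.onFun, Finset.disjoint_left]
    intro σ h1 h2
    simp only [Finset.mem_filter, Finset.mem_univ, true_and] at h1 h2
    exact hab (Subtype.ext (h1.symm.trans h2))

/-- Compared one cycle type at a time: its class has `n! / (∏ parts · ∏ multiplicities!)` elements,
and `countPerms` is `l! / ∏ multiplicities!`. Parts must be at least 2, since `cycleType` omits
fixed points. -/
theorem assocDerangements_mul_factorial {r : ℕ} (hr : 2 ≤ r) (n l : ℕ) :
    (assocDerangements r n l : ℝ) * l.factorial =
      n.factorial * PowerSeries.coeff n (cycleSeries r ^ l) := by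
  classical
  rw [assocDerangements_eq_sum, coeff_cycleSeries_pow, Nat.cast_sum, Finset.sum_mul,
    Finset.mul_sum]
  refine Finset.sum_congr rfl fun k hk => ?_
  split_ifs with hsum
  · have hmem : ∀ a ∈ k.val, 2 ≤ a := fun a ha =>
      hr.trans (Finset.mem_Icc.1 (Finset.mem_sym_iff.1 hk a ha)).1
    have h1 := Equiv.Perm.card_of_cycleType_mul_eq (Fin n) k.val
    rw [if_pos ⟨by rw [hsum, Fintype.card_fin], hmem⟩, Fintype.card_fin, hsum, Nat.sub_self, Nat.factorial_zero,
      one_mul] at h1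
    have h2 := k.val.countPerms_mul_prod_factorial
    rw [show Multiset.card k.val = l from k.2] at h2
    have h3 : (k.val.map fun i : ℕ => (i : ℝ)⁻¹).prod = ((k.val.prod : ℕ) : ℝ)⁻¹ := by
      rw [Multiset.prod_map_inv, Nat.cast_multiset_prod]
    have h4 : ((k.val.prod : ℕ) : ℝ) ≠ 0 := by
      rw [Nat.cast_ne_zero]
      exact Multiset.prod_ne_zero fun h0 => by simpa using hmem 0 h0
    rw [h3, ← h1, ← h2]
    simp only [Nat.cast_mul]
    field_simp
  · simp

/-! ### Truncation estimates for power series -/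

namespace PowerSeries

theorem hasSum_coeff_mul {f g : PowerSeries ℝ} {w a b : ℝ}
    (hf : HasSum (fun n => coeff n f * w ^ n) a) (hg : HasSum (fun n => coeff n g * w ^ n) b) :
    HasSum (fun n => coeff n (f * g) * w ^ n) (a * b) := by
  have hterm : ∀ n, ∑ kl ∈ Finset.HasAntidiagonal.antidiagonal n,
      (coeff kl.1 f * w ^ kl.1) * (coeff kl.2 g * w ^ kl.2) = coeff n (f * g) * w ^ n := by
    intro n
    rw [coeff_mul, Finset.sum_mul]
    refine Finset.sum_congr rfl fun kl hkl => ?_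
    rw [← Finset.HasAntidiagonal.mem_antidiagonal.1 hkl]
    ring
  have hs := summable_norm_sum_mul_antidiagonal_of_summable_norm hf.summable.norm hg.summable.norm
  have ht := tsum_mul_tsum_eq_tsum_sum_antidiagonal_of_summable_norm hf.summable.norm
    hg.summable.norm
  rw [hf.tsum_eq, hg.tsum_eq] at ht
  simp only [hterm] at hs ht
  rw [ht]
  exact hs.of_norm.hasSum

theorem hasSum_coeff_pow {f : PowerSeries ℝ} {w a : ℝ}
    (hf : HasSum (fun n => coeff n f * w ^ n) a) (l : ℕ) :
    HasSum (fun n => coeff n (f ^ l) * w ^ n) (a ^ l) := by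
  induction l with
  | zero =>
    have h := hasSum_single (f := fun n => coeff n (1 : PowerSeries ℝ) * w ^ n) 0
      (fun n hn => by simp [coeff_one, hn])
    simpa using h
  | succ l ih =>
    rw [pow_succ, pow_succ]
    exact hasSum_coeff_mul ih hf

theorem coeff_pow_nonneg {f : PowerSeries ℝ} (hf : ∀ n, 0 ≤ coeff n f) (l n : ℕ) :
    0 ≤ coeff n (f ^ l) := by
  induction l generalizing n with
  | zero => rw [pow_zero, coeff_one]; split_ifs <;> norm_num
  | succ l ih =>
    rw [pow_succ, coeff_mul]
    exact Finset.sum_nonneg fun kl _ => mul_nonneg (ih _) (hf _)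

theorem coeff_pow_eq_zero_of_lt {f : PowerSeries ℝ} (hf : coeff 0 f = 0) {l n : ℕ} (h : n < l) :
    coeff n (f ^ l) = 0 := by
  have hX : (X : PowerSeries ℝ) ∣ f := X_dvd_iff.2 (by simpa using hf)
  exact X_pow_dvd_iff.1 (pow_dvd_pow_of_dvd hX l) n h

/-- Comparison of the tail of a power series with nonnegative coefficients with its value at a
larger radius. -/
theorem abs_sub_sum_range_le {f : PowerSeries ℝ} (hf : ∀ n, 0 ≤ coeff n f) {w ρ a b : ℝ}
    (hρ : 0 < ρ) (hw : |w| ≤ ρ) (ha : HasSum (fun n => coeff n f * w ^ n) a)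
    (hb : HasSum (fun n => coeff n f * ρ ^ n) b) (R : ℕ) :
    |a - ∑ n ∈ Finset.range R, coeff n f * w ^ n| ≤ (|w| / ρ) ^ R * b := by
  have ha' := (hasSum_nat_add_iff' R).2 ha
  have hb' := (hasSum_nat_add_iff' R).2 hb
  have hnn : ∀ n, 0 ≤ coeff n f * ρ ^ n := fun n => mul_nonneg (hf n) (by positivity)
  have hle : b - ∑ n ∈ Finset.range R, coeff n f * ρ ^ n ≤ b :=
    sub_le_self _ (Finset.sum_nonneg fun n _ => hnn n)
  refine le_trans ?_ (mul_le_mul_of_nonneg_left hle (by positivity))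
  rw [← ha'.tsum_eq, ← Real.norm_eq_abs]
  refine tsum_of_norm_bounded (hb'.mul_left ((|w| / ρ) ^ R)) fun n => ?_
  rw [norm_mul, norm_pow, Real.norm_eq_abs, Real.norm_eq_abs, abs_of_nonneg (hf _)]
  calc coeff (n + R) f * |w| ^ (n + R) = coeff (n + R) f * (|w| ^ n * |w| ^ R) := by rw [pow_add]
    _ ≤ coeff (n + R) f * (ρ ^ n * |w| ^ R) := by
        gcongr
        exact hf _
    _ = (|w| / ρ) ^ R * (coeff (n + R) f * ρ ^ (n + R)) := by
        rw [div_pow, pow_add]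
        field_simp

/-- Truncation error of the exponential of `t f(w)`, in powers of `w`. -/
theorem abs_exp_sub_sum_le {f : PowerSeries ℝ} (hf : ∀ n, 0 ≤ coeff n f) (hf0 : coeff 0 f = 0)
    {w ρ a b : ℝ} (hρ : 0 < ρ) (hw : |w| ≤ ρ) (ha : HasSum (fun n => coeff n f * w ^ n) a)
    (hb : HasSum (fun n => coeff n f * ρ ^ n) b) (t : ℝ) (R : ℕ) :
    |Real.exp (t * a) - ∑ l ∈ Finset.range R, t ^ l / l.factorial *
        ∑ n ∈ Finset.range R, coeff n (f ^ l) * w ^ n| ≤ (|w| / ρ) ^ R * Real.exp (|t| * b) := by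
  have hexp : ∀ y : ℝ, HasSum (fun l : ℕ => y ^ l / l.factorial) (Real.exp y) := fun y => by
    rw [Real.exp_eq_exp_ℝ]
    exact NormedSpace.expSeries_div_hasSum_exp y
  -- Since `f` has no constant term, `f ^ l` has no coefficients below degree `l`; the terms with `l
  -- ≥ R` vanish and the finite sum is a full series, comparable term by term with the exponential.
  have h1 : HasSum (fun l : ℕ => t ^ l / l.factorial *
      ∑ n ∈ Finset.range R, coeff n (f ^ l) * w ^ n)
      (∑ l ∈ Finset.range R, t ^ l / l.factorial *
        ∑ n ∈ Finset.range R, coeff n (f ^ l) * w ^ n) := by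
    refine hasSum_sum_of_ne_finset_zero fun l hl => ?_
    rw [Finset.mem_range, not_lt] at hl
    rw [Finset.sum_eq_zero, mul_zero]
    intro n hn
    rw [coeff_pow_eq_zero_of_lt hf0 ((Finset.mem_range.1 hn).trans_le hl), zero_mul]
  have h2 := (hexp (t * a)).sub h1
  rw [← h2.tsum_eq, ← Real.norm_eq_abs]
  refine tsum_of_norm_bounded ((hexp (|t| * b)).mul_left ((|w| / ρ) ^ R)) fun l => ?_
  have h3 := abs_sub_sum_range_le (coeff_pow_nonneg hf l) hρ hw (hasSum_coeff_pow ha l)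
    (hasSum_coeff_pow hb l) R
  rw [mul_pow, mul_div_right_comm, ← mul_sub, norm_mul, norm_div, norm_pow, Real.norm_eq_abs,
    Real.norm_eq_abs, Real.norm_eq_abs, Nat.abs_cast]
  calc |t| ^ l / l.factorial * |a ^ l - ∑ n ∈ Finset.range R, coeff n (f ^ l) * w ^ n|
      ≤ |t| ^ l / l.factorial * ((|w| / ρ) ^ R * b ^ l) := by gcongr
    _ = (|w| / ρ) ^ R * ((|t| * b) ^ l / l.factorial) := by rw [mul_pow]; ring

end PowerSeries

/-! ### The logarithm beyond its quadratic term -/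

/-- The power series `∑_{m ≥ 1} X ^ m / (m + 2)`. -/
noncomputable def logRemainderSeries : PowerSeries ℝ :=
  PowerSeries.mk fun m => if 1 ≤ m then ((m + 2 : ℕ) : ℝ)⁻¹ else 0

/-- The sum `(-log (1 - w) - w - w ^ 2 / 2) / w ^ 2` of `logRemainderSeries`. -/
noncomputable def logRemainder (w : ℝ) : ℝ :=
  (-Real.log (1 - w) - w - w ^ 2 / 2) / w ^ 2

theorem cycleSeries_three : cycleSeries 3 = PowerSeries.X ^ 2 * logRemainderSeries := by
  ext n
  rw [PowerSeries.coeff_X_pow_mul', cycleSeries, logRemainderSeries, PowerSeries.coeff_mk,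
    PowerSeries.coeff_mk]
  by_cases h : 2 ≤ n
  · obtain ⟨m, rfl⟩ := Nat.exists_eq_add_of_le' h
    simp [show 3 ≤ m + 2 ↔ 1 ≤ m by omega]
  · simp [h, show ¬ 3 ≤ n by omega]

theorem coeff_logRemainderSeries_nonneg (n : ℕ) : 0 ≤ PowerSeries.coeff n logRemainderSeries := by
  rw [logRemainderSeries, PowerSeries.coeff_mk]
  split_ifs <;> positivity

theorem coeff_zero_logRemainderSeries : PowerSeries.coeff 0 logRemainderSeries = 0 := by
  simp [logRemainderSeries]

theorem hasSum_logRemainder {w : ℝ} (hw : |w| < 1) :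
    HasSum (fun n => PowerSeries.coeff n logRemainderSeries * w ^ n) (logRemainder w) := by
  have h1 := (hasSum_nat_add_iff' 2).2 (Real.hasSum_pow_div_log_of_abs_lt_one hw)
  have h2 := h1.div_const (w ^ 2)
  rw [← hasSum_nat_add_iff' 1]
  simp only [Finset.sum_range_one, coeff_zero_logRemainderSeries, zero_mul, sub_zero]
  -- At `w = 0` the quotient is `0 / 0 = 0`, which is the correct sum.
  rcases eq_or_ne w 0 with rfl | hw0
  · simp [logRemainder]
  · have h3 : ∀ n : ℕ, PowerSeries.coeff (n + 1) logRemainderSeries * w ^ (n + 1) =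
        w ^ (n + 2 + 1) / (((n + 2 : ℕ) : ℝ) + 1) / w ^ 2 := fun n => by
      rw [logRemainderSeries, PowerSeries.coeff_mk, if_pos (Nat.le_add_left 1 n)]
      push_cast
      field_simp
      ring
    have h4 : logRemainder w =
        (-Real.log (1 - w) - ∑ i ∈ Finset.range 2, w ^ (i + 1) / ((i : ℝ) + 1)) / w ^ 2 := by
      simp only [logRemainder, Finset.sum_range_succ, Finset.sum_range_zero]
      norm_num
      ring
    simp only [h3]
    rw [h4]
    exact h2

theorem assocDerangements_three (r l : ℕ) :
    (assocDerangements 3 (r + 2 * l) l : ℝ) * l.factorial =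
      (r + 2 * l).factorial * PowerSeries.coeff r (logRemainderSeries ^ l) := by
  rw [assocDerangements_mul_factorial (by norm_num), cycleSeries_three, mul_pow, ← pow_mul,
    PowerSeries.coeff_X_pow_mul]

/-! ### Gaussian moments -/

open MeasureTheory Set

theorem integral_abs_pow_mul_exp_neg_mul_sq (n : ℕ) {b : ℝ} (hb : 0 < b) :
    ∫ s : ℝ, |s| ^ n * Real.exp (-b * s ^ 2) =
      b ^ (-((n : ℝ) + 1) / 2) * Real.Gamma (((n : ℝ) + 1) / 2) := by
  have h1 := integral_comp_abs (f := fun s : ℝ => s ^ n * Real.exp (-b * s ^ 2))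
  simp only [sq_abs] at h1
  have h2 := integral_rpow_mul_exp_neg_mul_rpow (p := 2) (q := n) (b := b) two_pos
    (neg_one_lt_zero.trans_le n.cast_nonneg) hb
  simp only [Real.rpow_natCast, Real.rpow_two] at h2
  rw [h1, h2]
  ring

theorem integrable_abs_pow_mul_exp_neg_mul_sq (n : ℕ) {b : ℝ} (hb : 0 < b) :
    Integrable fun s : ℝ => |s| ^ n * Real.exp (-b * s ^ 2) := by
  -- The integral of a non-integrable function is 0 by convention, so a nonzero value proves
  -- integrability.
  refine Integrable.of_integral_ne_zero ?_
  rw [integral_abs_pow_mul_exp_neg_mul_sq n hb]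
  have := Real.Gamma_pos_of_pos (s := ((n : ℝ) + 1) / 2) (by positivity)
  positivity

theorem integrable_abs_pow_mul_exp_neg_mul_abs (n : ℕ) {c : ℝ} (hc : 0 < c) :
    Integrable fun s : ℝ => |s| ^ n * Real.exp (-(c * |s|)) := by
  refine Integrable.of_integral_ne_zero ?_
  have h1 := integral_comp_abs (f := fun s : ℝ => s ^ n * Real.exp (-(c * s)))
  have h2 := Real.integral_rpow_mul_exp_neg_mul_Ioi (a := (n : ℝ) + 1) (r := c) (by positivity) hc
  simp only [add_sub_cancel_right, Real.rpow_natCast] at h2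
  rw [h1, h2]
  have := Real.Gamma_pos_of_pos (s := (n : ℝ) + 1) (by positivity)
  positivity

theorem integrable_pow_mul_exp_neg_sq_div_two (n : ℕ) :
    Integrable fun s : ℝ => s ^ n * Real.exp (-s ^ 2 / 2) := by
  refine (integrable_abs_pow_mul_exp_neg_mul_sq n (b := 1 / 2) (by norm_num)).mono'
    (by fun_prop) (Filter.Eventually.of_forall fun s => le_of_eq ?_)
  rw [norm_mul, norm_pow, Real.norm_eq_abs, Real.norm_of_nonneg (Real.exp_pos _).le]
  ring_nf

theorem integral_pow_even_mul_exp_neg_sq_div_two (p : ℕ) :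
    ∫ s : ℝ, s ^ (2 * p) * Real.exp (-s ^ 2 / 2) =
      Real.sqrt (2 * Real.pi) * ((2 * p).factorial / (2 ^ p * p.factorial)) := by
  have h := integral_abs_pow_mul_exp_neg_mul_sq (2 * p) (b := 1 / 2) (by norm_num)
  have h1 : ∀ s : ℝ, |s| ^ (2 * p) * Real.exp (-(1 / 2) * s ^ 2) =
      s ^ (2 * p) * Real.exp (-s ^ 2 / 2) := fun s => by
    rw [(even_two_mul p).pow_abs]; ring_nf
  simp only [h1] at h
  have h2 : (((2 * p : ℕ) : ℝ) + 1) / 2 = p + 1 / 2 := by push_cast; ring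
  have h3 : (1 / 2 : ℝ) ^ (-(((2 * p : ℕ) : ℝ) + 1) / 2) = 2 ^ p * Real.sqrt 2 := by
    rw [neg_div, h2, one_div, Real.inv_rpow zero_le_two, Real.rpow_neg zero_le_two, inv_inv,
      Real.rpow_add two_pos, Real.rpow_natCast, Real.sqrt_eq_rpow, one_div]
  have h4 : ((2 * p).factorial : ℝ) = 2 ^ p * p.factorial * (2 * p - 1 : ℕ).doubleFactorial := by
    rcases p with _ | p
    · simp
    · rw [show 2 * (p + 1) = (2 * p + 1) + 1 by ring, Nat.factorial_eq_mul_doubleFactorial,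
        show 2 * p + 1 + 1 = 2 * (p + 1) by ring, Nat.doubleFactorial_two_mul]
      push_cast
      rfl
  rw [h, h3, h2, Real.Gamma_nat_add_half, h4, Real.sqrt_mul zero_le_two]
  field_simp

theorem integral_pow_odd_mul_exp_neg_sq_div_two {n : ℕ} (hn : Odd n) :
    ∫ s : ℝ, s ^ n * Real.exp (-s ^ 2 / 2) = 0 := by
  have h := integral_neg_eq_self (fun s : ℝ => s ^ n * Real.exp (-s ^ 2 / 2)) volume
  simp only [hn.neg_pow, neg_sq, neg_mul, integral_neg] at h
  linarith

/-! ### The rescaled Gamma integrand -/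

/-- The integrand of `x ^ (-x) e ^ x Γ(x)`, centred at its maximum and rescaled by `√x`. -/
noncomputable def gammaIntegrand (x s : ℝ) : ℝ :=
  (Ioi 0).indicator (fun v : ℝ => v ^ x * Real.exp (x * (1 - v))) (1 + s / Real.sqrt x)

theorem integral_gammaIntegrand {x : ℝ} (hx : 0 < x) :
    ∫ s, gammaIntegrand x s = Real.sqrt x * (Real.exp x * x ^ (-x) * Real.Gamma x) := by
  have hsq : 0 < Real.sqrt x := Real.sqrt_pos.2 hx
  -- With `Γ(x + 1)` the power is `v ^ x`, so the peak is exactly at `v = 1`.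
  have h := Real.integral_rpow_mul_exp_neg_mul_Ioi (a := x + 1) (r := x) (by positivity) hx
  rw [add_sub_cancel_right, Real.Gamma_add_one hx.ne', one_div, Real.inv_rpow hx.le,
    ← Real.rpow_neg hx.le, neg_add, Real.rpow_add hx, Real.rpow_neg_one] at h
  let g := (Ioi (0 : ℝ)).indicator (fun v : ℝ => v ^ x * Real.exp (x * (1 - v)))
  calc ∫ s, gammaIntegrand x s = |Real.sqrt x| • ∫ v, g (1 + v) :=
        Measure.integral_comp_div (fun v => g (1 + v)) (Real.sqrt x)
    _ = Real.sqrt x * ∫ v, g v := by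
        rw [integral_add_left_eq_self g 1, abs_of_pos hsq, smul_eq_mul]
    _ = Real.sqrt x * ∫ v in Ioi (0 : ℝ), Real.exp x * (v ^ x * Real.exp (-(x * v))) := by
        rw [integral_indicator measurableSet_Ioi]
        congr 2
        ext v
        rw [show x * (1 - v) = x + -(x * v) by ring, Real.exp_add]
        ring
    _ = _ := by
        rw [integral_const_mul, h]
        field_simp

theorem integrable_gammaIntegrand {x : ℝ} (hx : 0 < x) : Integrable (gammaIntegrand x) := by
  refine Integrable.of_integral_ne_zero ?_
  rw [integral_gammaIntegrand hx]
  have := Real.Gamma_pos_of_pos hx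
  positivity

theorem gammaIntegrand_eq_exp {x s : ℝ} (h : 0 < 1 + s / Real.sqrt x) :
    gammaIntegrand x s =
      Real.exp (x * (Real.log (1 + s / Real.sqrt x) - s / Real.sqrt x)) := by
  rw [gammaIntegrand, indicator_of_mem (mem_Ioi.2 h), Real.rpow_def_of_pos h, ← Real.exp_add]
  ring_nf

theorem gammaIntegrand_eq_exp_logRemainder {x s : ℝ} (hx : 0 < x)
    (h : 0 < 1 + s / Real.sqrt x) :
    gammaIntegrand x s =
      Real.exp (-s ^ 2 / 2) * Real.exp (-s ^ 2 * logRemainder (-(s / Real.sqrt x))) := by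
  rw [gammaIntegrand_eq_exp h, ← Real.exp_add]
  congr 1
  set w := s / Real.sqrt x with hw
  have hs : s ^ 2 = x * w ^ 2 := by
    rw [hw, div_pow, Real.sq_sqrt hx.le]
    field_simp
  rw [hs, logRemainder, sub_neg_eq_add, neg_sq]
  rcases eq_or_ne w 0 with h0 | h0
  · simp [h0]
  · field_simp
    ring_nf

theorem logRemainder_nonneg {w : ℝ} (h0 : 0 ≤ w) (h1 : w < 1) : 0 ≤ logRemainder w := by
  rw [← (hasSum_logRemainder (by rwa [abs_of_nonneg h0])).tsum_eq]
  exact tsum_nonneg fun n => mul_nonneg (coeff_logRemainderSeries_nonneg n) (by positivity)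

/-- Any bound below `1/2` would leave some Gaussian decay in `exp (-s²/2 + s² L(1/3))`. -/
theorem logRemainder_third_le : logRemainder (1 / 3) ≤ 1 / 4 := by
  have h : -Real.log (1 - 1 / 3) ≤ 5 / 12 := by
    rw [← Real.log_inv, Real.log_le_iff_le_exp (by norm_num)]
    refine le_trans ?_ (Real.quadratic_le_exp_of_nonneg (by norm_num))
    norm_num
  rw [logRemainder, div_le_iff₀ (by norm_num)]
  linarith

/-- For `u ≥ 0`, use the tangent to the concave logarithm at `4/3`; for `u < 0`, `log (1 + u) - u ≤
-u²/2 ≤ -|u|/6`. -/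
theorem log_one_add_sub_le {u : ℝ} (h1 : -1 < u) (h2 : 1 / 3 ≤ |u|) :
    Real.log (1 + u) - u ≤ -(|u| / 10) := by
  rcases le_total 0 u with h | h
  · rw [abs_of_nonneg h] at h2 ⊢
    have ha : Real.log (4 / 3) ≤ 3 / 10 := by
      rw [Real.log_le_iff_le_exp (by norm_num)]
      refine le_trans ?_ (Real.quadratic_le_exp_of_nonneg (by norm_num))
      norm_num
    have hb := Real.log_le_sub_one_of_pos (x := (1 + u) / (4 / 3)) (by positivity)
    rw [Real.log_div (by positivity) (by norm_num)] at hb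
    linarith
  · rw [abs_of_nonpos h] at h2 ⊢
    have hw := logRemainder_nonneg (w := -u) (by linarith) (by linarith)
    have hu : 0 < u ^ 2 := by nlinarith
    rw [logRemainder, neg_sq, sub_neg_eq_add, sub_neg_eq_add, le_div_iff₀ hu, zero_mul] at hw
    nlinarith

theorem gammaIntegrand_nonneg (x s : ℝ) : 0 ≤ gammaIntegrand x s := by
  refine indicator_nonneg (fun v hv => ?_) _
  have := mem_Ioi.1 hv
  positivity

theorem gammaIntegrand_le_exp {x s : ℝ} (hx : 1 ≤ x) (hs : 1 / 3 ≤ |s / Real.sqrt x|) :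
    gammaIntegrand x s ≤ Real.exp (-(1 / 10 * |s|)) := by
  have hx0 : 0 < x := zero_lt_one.trans_le hx
  have hsq : 1 ≤ Real.sqrt x := Real.one_le_sqrt.2 hx
  by_cases h : 0 < 1 + s / Real.sqrt x
  · rw [gammaIntegrand_eq_exp h, Real.exp_le_exp]
    have h1 := log_one_add_sub_le (by linarith) hs
    have h2 : |s| ≤ x * |s / Real.sqrt x| := by
      rw [abs_div, abs_of_pos (zero_lt_one.trans_le hsq), mul_div_assoc', le_div_iff₀
        (zero_lt_one.trans_le hsq), mul_comm]
      gcongr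
      exact (Real.sqrt_le_left hx0.le).2 (by nlinarith)
    nlinarith
  · rw [gammaIntegrand, indicator_of_notMem (by simpa using h)]
    positivity

/-! ### Uniform error bound for the integrand -/

/-- The expansion of `exp (-s² logRemainder w)` in powers of `w`, up to order `R`. -/
noncomputable def truncatedExpansion (R : ℕ) (s w : ℝ) : ℝ :=
  ∑ l ∈ Finset.range R, (-s ^ 2) ^ l / l.factorial *
    ∑ r ∈ Finset.range R, PowerSeries.coeff r (logRemainderSeries ^ l) * w ^ r

/-- A bound for `truncatedExpansion R s w` when `|w| ≤ |s|`. -/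
noncomputable def expansionMajorant (R : ℕ) (s : ℝ) : ℝ :=
  ∑ l ∈ Finset.range R, ∑ r ∈ Finset.range R,
    PowerSeries.coeff r (logRemainderSeries ^ l) / l.factorial * |s| ^ (2 * l + r)

theorem abs_truncatedExpansion_le (R : ℕ) {s w : ℝ} (h : |w| ≤ |s|) :
    |truncatedExpansion R s w| ≤ expansionMajorant R s := by
  refine (Finset.abs_sum_le_sum_abs _ _).trans (Finset.sum_le_sum fun l _ => ?_)
  rw [Finset.mul_sum]
  refine (Finset.abs_sum_le_sum_abs _ _).trans (Finset.sum_le_sum fun r _ => ?_)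
  have hE := PowerSeries.coeff_pow_nonneg coeff_logRemainderSeries_nonneg l r
  rw [abs_mul, abs_mul, abs_div, abs_pow, abs_pow, abs_neg, abs_pow, Nat.abs_cast,
    abs_of_nonneg hE, pow_add, pow_mul]
  calc (|s| ^ 2) ^ l / l.factorial * (PowerSeries.coeff r (logRemainderSeries ^ l) * |w| ^ r)
      ≤ (|s| ^ 2) ^ l / l.factorial *
          (PowerSeries.coeff r (logRemainderSeries ^ l) * |s| ^ r) := by gcongr
    _ = _ := by ring

/-- An integrable majorant for the truncation error. -/
noncomputable def errorMajorant (R : ℕ) (s : ℝ) : ℝ :=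
  (3 * |s|) ^ R * (Real.exp (-(1 / 4) * s ^ 2) + Real.exp (-(1 / 10 * |s|)) +
    expansionMajorant R s * Real.exp (-(1 / 2) * s ^ 2))

theorem integrable_errorMajorant (R : ℕ) : Integrable (errorMajorant R) := by
  have h1 := (integrable_abs_pow_mul_exp_neg_mul_sq R (b := 1 / 4) (by norm_num)).const_mul (3 ^ R)
  have h2 := (integrable_abs_pow_mul_exp_neg_mul_abs R (c := 1 / 10) (by norm_num)).const_mul (3 ^ R)
  have h3 : Integrable fun s : ℝ => ∑ l ∈ Finset.range R, ∑ r ∈ Finset.range R,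
      3 ^ R * (PowerSeries.coeff r (logRemainderSeries ^ l) / l.factorial) *
        (|s| ^ (R + (2 * l + r)) * Real.exp (-(1 / 2) * s ^ 2)) :=
    integrable_finsetSum _ fun l _ => integrable_finsetSum _ fun r _ =>
      (integrable_abs_pow_mul_exp_neg_mul_sq _ (by norm_num)).const_mul _
  refine ((h1.add h2).add h3).congr (Filter.Eventually.of_forall fun s => ?_)
  simp only [Pi.add_apply, errorMajorant, expansionMajorant, mul_add, Finset.sum_mul,
    Finset.mul_sum, mul_pow, pow_add]
  congr 1
  · ring
  · refine Finset.sum_congr rfl fun l _ => Finset.sum_congr rfl fun r _ => ?_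
    ring

theorem abs_gammaIntegrand_sub_le (R : ℕ) {x : ℝ} (hx : 1 ≤ x) (s : ℝ) :
    |gammaIntegrand x s -
        Real.exp (-s ^ 2 / 2) * truncatedExpansion R s (-(s / Real.sqrt x))| ≤
      (1 / Real.sqrt x) ^ R * errorMajorant R s := by
  have hx0 : 0 < x := zero_lt_one.trans_le hx
  have hsq : 1 ≤ Real.sqrt x := Real.one_le_sqrt.2 hx
  have hsq0 : 0 < Real.sqrt x := zero_lt_one.trans_le hsq
  set w := s / Real.sqrt x with hw
  have hwabs : |w| = |s| / Real.sqrt x := by rw [hw, abs_div, abs_of_pos hsq0]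
  have hpow : (1 / Real.sqrt x) ^ R * (3 * |s|) ^ R = (3 * |w|) ^ R := by
    rw [← mul_pow, hwabs]; ring_nf
  have hM : 0 ≤ expansionMajorant R s :=
    (abs_nonneg _).trans (abs_truncatedExpansion_le R le_rfl)
  have e1 := Real.exp_pos (-(1 / 4) * s ^ 2)
  have e2 := Real.exp_pos (-(1 / 10 * |s|))
  have e3 : -s ^ 2 / 2 = -(1 / 2) * s ^ 2 := by ring
  have e4 := Real.exp_pos (-(1 / 2) * s ^ 2)
  rw [errorMajorant, ← mul_assoc, hpow, e3]
  rcases le_or_gt |w| (1 / 3) with h | h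
  · have hpos : 0 < 1 + w := by linarith [(abs_le.1 h).1]
    rw [gammaIntegrand_eq_exp_logRemainder hx0 hpos, ← hw, e3, ← mul_sub, abs_mul, abs_of_pos e4]
    have hE := PowerSeries.abs_exp_sub_sum_le coeff_logRemainderSeries_nonneg
      coeff_zero_logRemainderSeries (w := -w) (ρ := 1 / 3) (by norm_num) (by rwa [abs_neg])
      (hasSum_logRemainder (by rw [abs_neg]; linarith))
      (hasSum_logRemainder (by norm_num)) (-s ^ 2) R
    rw [abs_neg, abs_neg, abs_of_nonneg (sq_nonneg s), show |w| / (1 / 3) = 3 * |w| by ring] at hE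
    calc _ ≤ Real.exp (-(1 / 2) * s ^ 2) *
            ((3 * |w|) ^ R * Real.exp (s ^ 2 * logRemainder (1 / 3))) := by
          gcongr
          exact hE
      _ ≤ Real.exp (-(1 / 2) * s ^ 2) * ((3 * |w|) ^ R * Real.exp (s ^ 2 * (1 / 4))) := by
          gcongr
          exact logRemainder_third_le
      _ = (3 * |w|) ^ R * Real.exp (-(1 / 4) * s ^ 2) := by
          rw [mul_left_comm, ← Real.exp_add]
          ring_nf
      _ ≤ _ := by
          gcongr
          have := mul_nonneg hM e4.le
          linarith
  -- Away from the peak the factor `(3|w|)^R` is at least 1, so integrand and expansion may be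
  -- bounded separately, without cancellation.
  · have h1 : 1 ≤ (3 * |w|) ^ R := one_le_pow₀ (by linarith)
    have h2 := gammaIntegrand_le_exp hx h.le
    have h3 := gammaIntegrand_nonneg x s
    have h4 := abs_truncatedExpansion_le R (s := s) (w := -w) (by
      rw [abs_neg, hwabs]
      exact div_le_self (abs_nonneg s) hsq)
    have h5 := mul_le_mul_of_nonneg_left h4 e4.le
    calc _ ≤ gammaIntegrand x s +
            Real.exp (-(1 / 2) * s ^ 2) * |truncatedExpansion R s (-w)| := by
          refine (abs_sub _ _).trans (le_of_eq ?_)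
          rw [abs_mul, abs_of_nonneg h3, abs_of_pos e4]
      _ ≤ 1 * (Real.exp (-(1 / 4) * s ^ 2) + Real.exp (-(1 / 10 * |s|)) +
            expansionMajorant R s * Real.exp (-(1 / 2) * s ^ 2)) := by linarith
      _ ≤ _ := by
          gcongr

/-! ### Termwise integration and the expansion -/

/-- `L ^ l` is divisible by `X ^ l`, so terms with `l > 2k` vanish and the cutoff `m` is immaterial.
-/
theorem comtetCoeff_eq_sum {k m : ℕ} (h : 2 * k < m) :
    comtetCoeff k = ∑ l ∈ Finset.range m,
      (-1 : ℝ) ^ l / l.factorial * PowerSeries.coeff (2 * k) (logRemainderSeries ^ l) *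
        ((2 * (l + k)).factorial / (2 ^ (l + k) * (l + k).factorial)) := by
  rw [comtetCoeff, ← Finset.sum_subset (Finset.range_mono h)]
  · refine Finset.sum_congr rfl fun l _ => ?_
    have hd := assocDerangements_three (2 * k) l
    rw [show 2 * k + 2 * l = 2 * (l + k) by ring] at hd
    rw [eq_div_of_mul_eq (Nat.cast_ne_zero.2 l.factorial_ne_zero) hd]
    field_simp
  · intro l _ hl
    rw [Finset.mem_range, not_lt] at hl
    rw [PowerSeries.coeff_pow_eq_zero_of_lt coeff_zero_logRemainderSeries hl]
    ring

theorem exp_mul_truncatedExpansion (R : ℕ) (s ε : ℝ) :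
    Real.exp (-s ^ 2 / 2) * truncatedExpansion R s (-(s * ε)) =
      ∑ r ∈ Finset.range R, ∑ l ∈ Finset.range R,
        (-1) ^ l / l.factorial * PowerSeries.coeff r (logRemainderSeries ^ l) * (-ε) ^ r *
          (s ^ (2 * l + r) * Real.exp (-s ^ 2 / 2)) := by
  rw [truncatedExpansion, Finset.mul_sum, Finset.sum_comm]
  refine Finset.sum_congr rfl fun l _ => ?_
  rw [Finset.mul_sum, Finset.mul_sum]
  refine Finset.sum_congr rfl fun r _ => ?_
  rw [← mul_neg, mul_pow, pow_add, pow_mul, neg_pow (s ^ 2)]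
  ring

theorem integrable_exp_mul_truncatedExpansion (R : ℕ) (ε : ℝ) :
    Integrable fun s : ℝ => Real.exp (-s ^ 2 / 2) * truncatedExpansion R s (-(s * ε)) := by
  simp only [exp_mul_truncatedExpansion]
  exact integrable_finsetSum _ fun r _ => integrable_finsetSum _ fun l _ =>
    (integrable_pow_mul_exp_neg_sq_div_two _).const_mul _

theorem Finset.sum_range_two_mul_of_odd_eq_zero {f : ℕ → ℝ} (hf : ∀ r, Odd r → f r = 0) (m : ℕ) :
    ∑ r ∈ Finset.range (2 * m), f r = ∑ k ∈ Finset.range m, f (2 * k) := by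
  induction m with
  | zero => simp
  | succ m ih =>
    rw [show 2 * (m + 1) = 2 * m + 1 + 1 by ring, Finset.sum_range_succ, Finset.sum_range_succ, ih,
      hf _ (odd_two_mul_add_one m), add_zero, Finset.sum_range_succ]

theorem integral_exp_mul_truncatedExpansion (m : ℕ) (ε : ℝ) :
    ∫ s : ℝ, Real.exp (-s ^ 2 / 2) * truncatedExpansion (2 * m) s (-(s * ε)) =
      Real.sqrt (2 * Real.pi) * ∑ k ∈ Finset.range m, comtetCoeff k * (ε ^ 2) ^ k := by
  simp only [exp_mul_truncatedExpansion]
  rw [integral_finsetSum _ fun r _ => integrable_finsetSum _ fun l _ =>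
    (integrable_pow_mul_exp_neg_sq_div_two _).const_mul _]
  rw [Finset.sum_range_two_mul_of_odd_eq_zero, Finset.mul_sum]
  · refine Finset.sum_congr rfl fun k hk => ?_
    rw [integral_finsetSum _ fun l _ => (integrable_pow_mul_exp_neg_sq_div_two _).const_mul _,
      comtetCoeff_eq_sum (m := 2 * m) (by linarith [Finset.mem_range.1 hk]), Finset.sum_mul,
      Finset.mul_sum]
    refine Finset.sum_congr rfl fun l _ => ?_
    rw [integral_const_mul, ← mul_add, integral_pow_even_mul_exp_neg_sq_div_two,
      (even_two_mul k).neg_pow, pow_mul]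
    ring
  · intro r hr
    rw [integral_finsetSum _ fun l _ => (integrable_pow_mul_exp_neg_sq_div_two _).const_mul _]
    refine Finset.sum_eq_zero fun l _ => ?_
    rw [integral_const_mul, integral_pow_odd_mul_exp_neg_sq_div_two ((even_two_mul l).add_odd hr),
      mul_zero]

theorem abs_integral_gammaIntegrand_sub_le (m : ℕ) {x : ℝ} (hx : 1 ≤ x) :
    |∫ s, gammaIntegrand x s -
        Real.exp (-s ^ 2 / 2) * truncatedExpansion (2 * m) s (-(s * (1 / Real.sqrt x)))| ≤
      1 / x ^ m * ∫ s, errorMajorant (2 * m) s := by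
  rw [← integral_const_mul, ← Real.norm_eq_abs]
  refine norm_integral_le_of_norm_le ((integrable_errorMajorant _).const_mul _)
    (Filter.Eventually.of_forall fun s => ?_)
  have h := abs_gammaIntegrand_sub_le (2 * m) hx s
  rwa [pow_mul, div_pow, one_pow, Real.sq_sqrt (zero_le_one.trans hx), div_pow, one_pow,
    div_eq_mul_one_div s] at h

/-- The expansion is an asymptotic expansion as `x → +∞`: after any number of terms, the remainder
`R` is of the order of the first omitted power of `1 / x`. -/
theorem mainTheorem8 (N : ℕ) :
    ∃ R : ℝ → ℝ,
      (∀ x : ℝ, 0 < x →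
        Real.Gamma x =
          x ^ x * Real.exp (-x) * (Real.sqrt (2 * Real.pi) / Real.sqrt x) *
            (∑ k ∈ Finset.range (N + 1), comtetCoeff k / x ^ k + R x)) ∧
      R =O[Filter.atTop] (fun x : ℝ => 1 / x ^ (N + 1)) := by
  have hpi : 0 < Real.sqrt (2 * Real.pi) := Real.sqrt_pos.2 (by positivity)
  -- The remainder is defined by solving the identity for it; only its size needs an estimate.
  refine ⟨fun x => (∫ s, gammaIntegrand x s) / Real.sqrt (2 * Real.pi) -
    ∑ k ∈ Finset.range (N + 1), comtetCoeff k / x ^ k, fun x hx => ?_, ?_⟩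
  · have hsq : 0 < Real.sqrt x := Real.sqrt_pos.2 hx
    have hxx : 0 < x ^ x := Real.rpow_pos_of_pos hx x
    rw [add_sub_cancel, integral_gammaIntegrand hx, Real.rpow_neg hx.le, Real.exp_neg]
    field_simp
  · refine Asymptotics.IsBigO.of_bound
      ((∫ s, errorMajorant (2 * (N + 1)) s) / Real.sqrt (2 * Real.pi)) ?_
    filter_upwards [Filter.eventually_ge_atTop 1] with x hx
    have hx0 : 0 < x := zero_lt_one.trans_le hx
    have h := abs_integral_gammaIntegrand_sub_le (N + 1) hx
    rw [integral_sub (integrable_gammaIntegrand hx0) (integrable_exp_mul_truncatedExpansion _ _),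
      integral_exp_mul_truncatedExpansion] at h
    simp only [div_pow, one_pow, Real.sq_sqrt hx0.le, mul_one_div] at h
    rw [Real.norm_eq_abs, Real.norm_of_nonneg (by positivity), div_mul_eq_mul_div, le_div_iff₀ hpi,
      ← abs_of_pos hpi, ← abs_mul, abs_of_pos hpi, sub_mul, div_mul_cancel₀ _ hpi.ne',
      mul_comm (∑ k ∈ _, _), mul_comm (∫ s, errorMajorant _ s)]
    exact h
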